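/- Let $(R,\mathfrak m)$ be a Noetherian (commutative) local ring with $\mathfrak m$-adic completion $\widehat R$, and let $A$ be an Artinian $R$-module. Every element of $A$ is killed by a power of $\mathfrak m$, and $A$ carries its natural $\widehat R$-module structure: if $\mathfrak m^n a=0$, then $\widehat r\cdot a=ra$ for any $r\in R$ with $\widehat r\equiv r$ modulo $\mathfrak m^n\widehat R$. For an ideal $I$ of a ring let $V(I)$ be the set of all prime ideals containing $I$, and for an ideal $\mathfrak p$ of $R$ let $0:_A\mathfrak p=\{a\in A : \mathfrak p a=0\}$. Then the following conditions are equivalent: (i) $\operatorname{Ann}_R(0:_A\mathfrak p)=\mathfrak p$ for all $\mathfrak p\in V(\operatorname{Ann}_R A)$. (ii) $V(\operatorname{Ann}_R A)=\{\widehat{\mathfrak p}\cap R : \widehat{\mathfrak p}\in V(\operatorname{Ann}_{\widehat R}A)\}$, where $\widehat{\mathfrak p}\cap R$ is the preimage of $\widehat{\mathfrak p}$ under $R\to\widehat R$. -/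

import Mathlib

open IsLocalRing (maximalIdeal)

namespace ArtinianCompletion

section

variable {R : Type*} [CommRing R] [IsLocalRing R] [IsNoetherianRing R]
  {A : Type*} [AddCommGroup A] [Module R A] [IsArtinian R A]

/-- Every element of an Artinian module over a Noetherian local ring is killed by some power
of the maximal ideal. -/
theorem exists_pow_smul_eq_zero (a : A) :
    ∃ n : ℕ, ∀ r ∈ maximalIdeal R ^ n, r • a = 0 := by
  let N : Submodule R A := Submodule.span R {a}
  let f : ℕ →o (Submodule R A)ᵒᵈ :=
    ⟨fun n => OrderDual.toDual (maximalIdeal R ^ n • N), fun i j hij =>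
      Submodule.smul_mono_left (Ideal.pow_le_pow_right hij)⟩
  obtain ⟨n, hn⟩ := IsArtinian.monotone_stabilizes f
  have h1 : maximalIdeal R ^ n • N = maximalIdeal R ^ (n + 1) • N := hn (n + 1) (Nat.le_succ n)
  have hfg : (maximalIdeal R ^ n • N).FG :=
    Submodule.FG.smul (IsNoetherian.noetherian _) (Submodule.fg_span_singleton a)
  have h0 : maximalIdeal R ^ n • N = ⊥ := by
    refine Submodule.eq_bot_of_le_smul_of_le_jacobson_bot (maximalIdeal R) _ hfg ?_ ?_
    · rw [← Submodule.mul_smul, ← pow_succ', ← h1]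
    · exact (IsLocalRing.jacobson_eq_maximalIdeal ⊥ bot_ne_top).ge
  refine ⟨n, fun r hr => ?_⟩
  have := Submodule.smul_mem_smul hr (Submodule.mem_span_singleton_self (R := R) a)
  rwa [show maximalIdeal R ^ n • Submodule.span R {a} = ⊥ from h0, Submodule.mem_bot] at this

/-- The action of the completion on an Artinian module: if `𝔪 ^ n` kills `a`, then `x • a = r • a`
for any `r : R` which has the same residue class modulo `𝔪 ^ n` as `x`. The result does not depend
on the choices, see `completionSMul_eq`. -/
noncomputable def completionSMul (x : AdicCompletion (maximalIdeal R) R) (a : A) : A :=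
  (Ideal.Quotient.mk_surjective
    (AdicCompletion.evalₐ (maximalIdeal R) (exists_pow_smul_eq_zero (R := R) a).choose x)).choose • a

theorem smul_eq_of_evalₐ {x : AdicCompletion (maximalIdeal R) R} {a : A} {n k : ℕ} {r s : R}
    (hnk : n ≤ k) (hn : ∀ t ∈ maximalIdeal R ^ n, t • a = 0)
    (hr : Ideal.Quotient.mk _ r = AdicCompletion.evalₐ (maximalIdeal R) n x)
    (hs : Ideal.Quotient.mk _ s = AdicCompletion.evalₐ (maximalIdeal R) k x) :
    r • a = s • a := by
  obtain ⟨y, rfl⟩ := AdicCompletion.mk_surjective (maximalIdeal R) R x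
  rw [AdicCompletion.evalₐ_mk] at hr hs
  rw [← sub_eq_zero, ← sub_smul]
  apply hn
  have h1 := Ideal.Quotient.eq.mp hr
  have h2 := Ideal.pow_le_pow_right hnk (Ideal.Quotient.eq.mp hs)
  have h3 := Ideal.Quotient.eq.mp (AdicCompletion.Ideal.mk_eq_mk (maximalIdeal R) hnk y)
  have := Ideal.sub_mem _ (Ideal.sub_mem _ h1 h3) h2
  convert this using 1
  ring

theorem completionSMul_eq (x : AdicCompletion (maximalIdeal R) R) (a : A) {n : ℕ} {r : R}
    (hn : ∀ t ∈ maximalIdeal R ^ n, t • a = 0)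
    (hr : Ideal.Quotient.mk _ r = AdicCompletion.evalₐ (maximalIdeal R) n x) :
    completionSMul x a = r • a := by
  have hm := (exists_pow_smul_eq_zero (R := R) a).choose_spec
  have hs := (Ideal.Quotient.mk_surjective (AdicCompletion.evalₐ (maximalIdeal R)
    (exists_pow_smul_eq_zero (R := R) a).choose x)).choose_spec
  rcases le_total n (exists_pow_smul_eq_zero (R := R) a).choose with h | h
  · exact (smul_eq_of_evalₐ h hn hr hs).symm
  · exact smul_eq_of_evalₐ h hm hs hr

variable (R A) in
/-- The natural module structure over the `𝔪`-adic completion `R̂` of `R` on an Artinian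
`R`-module. This is a definition and not a global instance, in order not to compete with
other module structures over `R̂`. -/
@[reducible] noncomputable def completionModule :
    Module (AdicCompletion (maximalIdeal R) R) A where
  smul := completionSMul
  one_smul a := by
    obtain ⟨n, hn⟩ := exists_pow_smul_eq_zero (R := R) a
    exact (completionSMul_eq 1 a hn (r := 1) (by simp)).trans (one_smul R a)
  mul_smul x y a := by
    obtain ⟨n, hn⟩ := exists_pow_smul_eq_zero (R := R) a
    obtain ⟨r, hr⟩ := Ideal.Quotient.mk_surjective (AdicCompletion.evalₐ (maximalIdeal R) n x)
    obtain ⟨s, hs⟩ := Ideal.Quotient.mk_surjective (AdicCompletion.evalₐ (maximalIdeal R) n y)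
    change completionSMul (x * y) a = completionSMul x (completionSMul y a)
    rw [completionSMul_eq (x * y) a hn (r := r * s) (by simp [hr, hs]),
      completionSMul_eq y a hn hs,
      completionSMul_eq x (s • a) (n := n)
        (fun t ht => by rw [smul_comm, hn t ht, smul_zero]) hr, mul_smul]
  smul_zero x := by
    change completionSMul x (0 : A) = 0
    exact smul_zero _
  zero_smul a := by
    obtain ⟨n, hn⟩ := exists_pow_smul_eq_zero (R := R) a
    exact (completionSMul_eq 0 a hn (r := 0) (by simp)).trans (zero_smul R a)
  smul_add x a b := by
    obtain ⟨n, hn⟩ := exists_pow_smul_eq_zero (R := R) a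
    obtain ⟨k, hk⟩ := exists_pow_smul_eq_zero (R := R) b
    have hn' : ∀ t ∈ maximalIdeal R ^ max n k, t • a = 0 := fun t ht =>
      hn t (Ideal.pow_le_pow_right (le_max_left n k) ht)
    have hk' : ∀ t ∈ maximalIdeal R ^ max n k, t • b = 0 := fun t ht =>
      hk t (Ideal.pow_le_pow_right (le_max_right n k) ht)
    obtain ⟨r, hr⟩ :=
      Ideal.Quotient.mk_surjective (AdicCompletion.evalₐ (maximalIdeal R) (max n k) x)
    change completionSMul x (a + b) = completionSMul x a + completionSMul x b
    rw [completionSMul_eq x a hn' hr, completionSMul_eq x b hk' hr,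
      completionSMul_eq x (a + b) (n := max n k)
        (fun t ht => by rw [smul_add, hn' t ht, hk' t ht, add_zero]) hr, smul_add]
  add_smul x y a := by
    obtain ⟨n, hn⟩ := exists_pow_smul_eq_zero (R := R) a
    obtain ⟨r, hr⟩ := Ideal.Quotient.mk_surjective (AdicCompletion.evalₐ (maximalIdeal R) n x)
    obtain ⟨s, hs⟩ := Ideal.Quotient.mk_surjective (AdicCompletion.evalₐ (maximalIdeal R) n y)
    change completionSMul (x + y) a = completionSMul x a + completionSMul y a
    rw [completionSMul_eq (x + y) a hn (r := r + s) (by simp [hr, hs]),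
      completionSMul_eq x a hn hr, completionSMul_eq y a hn hs, add_smul]

/-- The action of the completion extends the action of `R`. -/
theorem completionSMul_algebraMap (r : R) (a : A) :
    completionSMul (algebraMap R (AdicCompletion (maximalIdeal R) R) r) a = r • a := by
  obtain ⟨n, hn⟩ := exists_pow_smul_eq_zero (R := R) a
  exact completionSMul_eq _ a hn (by simp)

variable (R A) in
/-- The annihilator of `A` as a module over the completion of `R`. -/
noncomputable def completionAnnihilator : Ideal (AdicCompletion (maximalIdeal R) R) :=
  letI := completionModule R A
  Module.annihilator (AdicCompletion (maximalIdeal R) R) A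

end

variable (R : Type*) [CommRing R] (A : Type*) [AddCommGroup A] [Module R A]

/-- Property (*): `Ann (0 :_A 𝔭) = 𝔭` for all prime ideals `𝔭 ⊇ Ann A`. Here
`Submodule.torsionBySet R A 𝔭` is the submodule `0 :_A 𝔭` of the elements killed by `𝔭`. -/
def PropertyStar : Prop :=
  ∀ p : Ideal R, p.IsPrime → Module.annihilator R A ≤ p →
    Module.annihilator R (Submodule.torsionBySet R A (p : Set R)) = p

end ArtinianCompletion

/-! Contracting `Ann_R̂ A` to `R` gives `Ann_R A`, so only two points need an argument. If `Ann_R (0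
:_A p) = p`, then `J = Ann_R̂ (0 :_A p)` contracts to `p`, and a prime over `J` contracts to `p`; it
contains `Ann_R̂ A` because `J` does. Conversely, if `p = P ∩ R`, then `0 :_A P ⊆ 0 :_A p`, so it
suffices that `Ann (0 :_A P) ⊆ P` over the complete ring `S = R̂`. This follows by Matlis duality.
Let `E` be an injective module with socle the residue field, and `D = Hom(A, E)`. Completeness makes
`D` finitely generated, and `Ann D ⊆ Ann A ⊆ P`, so `P` lies in the support of `D / P D`. Every map
vanishing on `0 :_A P` lies in `P D`, so `Ann (0 :_A P)` kills `D / P D` and is contained in `P`. -/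

/-! ### Injective hulls and an injective module with simple socle -/

/-- A submodule `K` of a module satisfying Baer's criterion has an injective hull inside it. -/
theorem Module.Baer.exists_essential_ge {S : Type*} [CommRing S] {Q : Type*} [AddCommGroup Q]
    [Module S Q] (hQ : Module.Baer S Q) (K : Submodule S Q) :
    ∃ E : Submodule S Q, K ≤ E ∧ Module.Baer S E ∧
      ∀ X : Submodule S Q, X ≤ E → X ⊓ K = ⊥ → X = ⊥ := by
  let essential : Set (Submodule S Q) :=
    {E | K ≤ E ∧ ∀ X : Submodule S Q, X ≤ E → X ⊓ K = ⊥ → X = ⊥}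
  have sup_mem {c : Set (Submodule S Q)} (hc : IsChain (· ≤ ·) c) {Y : Submodule S Q}
      (hY : Y ∈ c) {x : Q} (hx : x ∈ sSup c) : ∃ Z ∈ c, x ∈ Z :=
    (Submodule.mem_sSup_of_directed ⟨Y, hY⟩ hc.directedOn).mp hx
  obtain ⟨E, -, hE⟩ := zorn_le_nonempty₀ essential (fun c hc hchain Y hY => by
    refine ⟨sSup c, ⟨(hc hY).1.trans (le_sSup hY), fun X hX hXK => ?_⟩, fun _ => le_sSup⟩
    rw [eq_bot_iff]
    intro x hx
    obtain ⟨Z, hZ, hxZ⟩ := sup_mem hchain hY (hX hx)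
    have h0 : Submodule.span S {x} = ⊥ := (hc hZ).2 _ (by simpa using hxZ)
      (eq_bot_iff.mpr <| hXK ▸ inf_le_inf_right K (by simpa using hx))
    simpa using h0) K ⟨le_rfl, fun X hX hXK => by rwa [inf_eq_left.mpr hX] at hXK⟩
  -- With `D` maximal subject to `D ⊓ E = ⊥`, `E` embeds in `Q / D`, and its inclusion into `Q`
  -- extends to `f` on `Q / D`.
  obtain ⟨D, -, hD⟩ := zorn_le_nonempty₀ {D : Submodule S Q | D ⊓ E = ⊥}
    (fun c hc hchain Y hY => by
      refine ⟨sSup c, ?_, fun _ => le_sSup⟩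
      change sSup c ⊓ E = ⊥
      rw [eq_bot_iff]
      rintro x ⟨hx, hxE⟩
      obtain ⟨Z, hZ, hxZ⟩ := sup_mem hchain hY hx
      exact (hc hZ : Z ⊓ E = ⊥) ▸ (⟨hxZ, hxE⟩ : x ∈ Z ⊓ E)) ⊥ (bot_inf_eq E)
  have hDE : D ⊓ E = ⊥ := hD.1
  obtain ⟨⟨hKE, hess⟩, hEmax⟩ := hE
  have hinj : Function.Injective (D.mkQ ∘ₗ E.subtype) := by
    rw [← LinearMap.ker_eq_bot, LinearMap.ker_eq_bot']
    intro e he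
    have : (e : Q) ∈ D ⊓ E := ⟨by simpa using he, e.2⟩
    rw [hDE] at this
    simpa using this
  obtain ⟨f, hf⟩ := hQ.extension_property _ hinj E.subtype
  have hfE (e : Q) (he : e ∈ E) : f (D.mkQ e) = e := congr($hf ⟨e, he⟩)
  -- If `X` in the range meets `K` trivially, its preimage meets `E` trivially and contains `D`,
  -- hence equals `D`, which maps to zero. Maximality of `E` then makes `f ∘ₗ D.mkQ` a retraction of
  -- `Q` onto `E`, so `E` inherits injectivity.
  have hrange : LinearMap.range (f ∘ₗ D.mkQ) ∈ essential := by
    refine ⟨fun x hx => ⟨x, hfE x (hKE hx)⟩, fun X hX hXK => ?_⟩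
    have hle : X.comap (f ∘ₗ D.mkQ) ⊓ E = ⊥ := by
      refine hess _ inf_le_right (eq_bot_iff.mpr ?_)
      rintro x ⟨⟨hxX, hxE⟩, hxK⟩
      have : f (D.mkQ x) ∈ X := hxX
      rw [hfE x hxE] at this
      rw [← hXK]
      exact ⟨this, hxK⟩
    have hDX : D ≤ X.comap (f ∘ₗ D.mkQ) := by
      intro d hd
      have : D.mkQ d = 0 := by simpa using hd
      simp [LinearMap.comp_apply, this, -Submodule.mkQ_apply]
    have hXD := hD.2 hle hDX
    rw [eq_bot_iff]
    intro x hx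
    obtain ⟨y, rfl⟩ := hX hx
    have : y ∈ D := hXD hx
    have : D.mkQ y = 0 := by simpa using this
    simp [LinearMap.comp_apply, this, -Submodule.mkQ_apply]
  have hEr : LinearMap.range (f ∘ₗ D.mkQ) ≤ E := hEmax hrange fun x hx => ⟨x, hfE x hx⟩
  refine ⟨E, hKE, fun I g => ?_, hess⟩
  obtain ⟨g', hg'⟩ := hQ I (E.subtype ∘ₗ g)
  refine ⟨((f ∘ₗ D.mkQ).codRestrict E fun x => hEr ⟨x, rfl⟩) ∘ₗ g', fun x hx => ?_⟩
  refine Subtype.ext ?_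
  change f (D.mkQ (g' x)) = _
  rw [hg' x hx]
  exact hfE _ (g ⟨x, hx⟩).2

/-- Over a local ring there is an injective module whose socle is spanned by one nonzero element. -/
theorem IsLocalRing.exists_baer_socle_span_singleton (S : Type*) [CommRing S] [IsLocalRing S] :
    ∃ (E : Submodule S (CharacterModule S)) (x : E), Module.Baer S E ∧ x ≠ 0 ∧
      (∀ t ∈ maximalIdeal S, t • x = 0) ∧
      ∀ e : E, (∀ t ∈ maximalIdeal S, t • e = 0) → e ∈ Submodule.span S {x} := by
  obtain ⟨c, hc⟩ := CharacterModule.exists_character_apply_ne_zero_of_ne_zero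
    (one_ne_zero : (1 : S ⧸ maximalIdeal S) ≠ 0)
  let x : CharacterModule S := CharacterModule.dual (maximalIdeal S).mkQ c
  have hx1 : x 1 ≠ 0 := hc
  have hx (t : S) (ht : t ∈ maximalIdeal S) : t • x = 0 := by
    ext s
    have : (maximalIdeal S).mkQ (t • s) = 0 :=
      (Submodule.Quotient.mk_eq_zero _).mpr (Ideal.mul_mem_right s _ ht)
    change c ((maximalIdeal S).mkQ (t • s)) = 0
    rw [this, map_zero]
  obtain ⟨E, hKE, hE, hess⟩ := Module.Baer.exists_essential_ge
    (Module.Flat.iff_characterModule_baer.mp (inferInstance : Module.Flat S S))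
    (Submodule.span S {x})
  refine ⟨E, ⟨x, hKE (Submodule.mem_span_singleton_self x)⟩, hE, fun h => hx1 ?_,
    fun t ht => Subtype.ext (hx t ht), fun e he => ?_⟩
  · rw [show x = 0 from congr_arg Subtype.val h]
    rfl
  · by_cases h0 : e = 0
    · simp [h0]
    have hne : Submodule.span S {(e : CharacterModule S)} ⊓ Submodule.span S {x} ≠ ⊥ :=
      fun h => h0 <| by simpa using hess _ (by simp) h
    obtain ⟨y, ⟨hye, hyx⟩, hy0⟩ := Submodule.exists_mem_ne_zero_of_ne_bot hne
    obtain ⟨s, rfl⟩ := Submodule.mem_span_singleton.mp hye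
    obtain ⟨t, ht⟩ := Submodule.mem_span_singleton.mp hyx
    -- Since `𝔪` kills `e` while `s • e ≠ 0`, `s` is not in `𝔪`.
    have hs : IsUnit s := by
      by_contra hs
      exact hy0 congr(Subtype.val $(he s ((IsLocalRing.mem_maximalIdeal s).mpr hs)))
    obtain ⟨u, rfl⟩ := hs
    refine Submodule.mem_span_singleton.mpr ⟨↑u⁻¹ * t, Subtype.ext ?_⟩
    change (↑u⁻¹ * t) • x = _
    rw [mul_smul, ht, smul_smul, Units.inv_mul, one_smul]

/-! ### Completeness, and finiteness of torsion submodules -/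

/-- Limits are taken coordinatewise. This supplies the complete free source for the complete form of
Nakayama's lemma. -/
theorem IsPrecomplete.pi_fin {S : Type*} [CommRing S] (I : Ideal S) [IsPrecomplete I S] (n : ℕ) :
    IsPrecomplete I (Fin n → S) where
  prec' f hf := by
    have hcoord (j : Fin n) : ∃ L : S, ∀ k, f k j ≡ L [SMOD (I ^ k • ⊤ : Submodule S S)] := by
      refine IsPrecomplete.prec' (fun k => f k j) fun {a b} hab => ?_
      have h := hf hab
      rw [SModEq.sub_mem] at h ⊢
      have := Submodule.mem_map_of_mem (f := LinearMap.proj (R := S) (φ := fun _ => S) j) h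
      rw [Submodule.map_smul''] at this
      exact Submodule.smul_mono le_rfl le_top this
    choose L hL using hcoord
    refine ⟨L, fun k => ?_⟩
    rw [SModEq.sub_mem, pi_eq_sum_univ' (f k - L)]
    refine Submodule.sum_mem _ fun j _ => Submodule.smul_mem_smul ?_ trivial
    simpa [SModEq.sub_mem] using hL j k

/-- A module killed by a maximal ideal is semisimple. -/
theorem Module.IsTorsionBySet.isSemisimpleModule_of_isMaximal {S : Type*} [CommRing S]
    {m : Ideal S} [m.IsMaximal] {N : Type*} [AddCommGroup N] [Module S N]
    (h : Module.IsTorsionBySet S N (m : Set S)) : IsSemisimpleModule S N := by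
  let _ := Ideal.Quotient.field m
  let _ := h.module
  exact (h.isSemisimpleModule_iff).mp inferInstance

/-- A linear map to an injective module vanishing on `0 :_A I` lies in `I Hom(A, E)`. -/
theorem Module.Baer.mem_smul_top_of_torsionBySet_le_ker {S : Type*} [CommRing S]
    {E : Type*} [AddCommGroup E] [Module S E] (hE : Module.Baer S E)
    {A : Type*} [AddCommGroup A] [Module S A] {I : Ideal S} (hI : I.FG) {φ : A →ₗ[S] E}
    (hφ : Submodule.torsionBySet S A (I : Set S) ≤ LinearMap.ker φ) :
    φ ∈ I • (⊤ : Submodule S (A →ₗ[S] E)) := by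
  classical
  obtain ⟨s, rfl⟩ := hI
  -- The map `a ↦ (p a)` over the generators `p` has kernel inside `0 :_A I`, so `φ` factors through
  -- its image. Extending to `Φ : A^s → E` and splitting into components gives `φ = ∑ p Φ_p`.
  let g : A →ₗ[S] (s → A) := LinearMap.pi fun p => (p : S) • LinearMap.id
  have hker : LinearMap.ker g ≤ LinearMap.ker φ := by
    refine le_trans (fun a ha => ?_) hφ
    rw [← Submodule.torsionBySet_eq_torsionBySet_span, Submodule.mem_torsionBySet_iff]
    exact fun p => congr_fun (LinearMap.mem_ker.mp ha) p
  obtain ⟨Φ, hΦ⟩ := hE.extension_property ((LinearMap.ker g).liftQ g le_rfl)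
    (LinearMap.ker_eq_bot.mp (Submodule.ker_liftQ_eq_bot' _ g rfl)) ((LinearMap.ker g).liftQ φ hker)
  have key : φ = ∑ p : s, (p : S) • (Φ ∘ₗ LinearMap.single S (fun _ => A) p) := by
    ext a
    have h := congr($hΦ (Submodule.Quotient.mk a))
    simp only [LinearMap.comp_apply, Submodule.liftQ_apply] at h
    rw [← h, ← LinearMap.sum_single_apply (fun _ : s => A) (g a), map_sum,
      LinearMap.sum_apply]
    refine Finset.sum_congr rfl fun p _ => ?_
    rw [LinearMap.smul_apply, LinearMap.comp_apply, ← map_smul, ← map_smul]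
    rfl
  rw [key]
  exact Submodule.sum_mem _ fun p _ =>
    Submodule.smul_mem_smul (Submodule.subset_span p.2) trivial

/-- In an Artinian module, `0 :_A P` only depends on a finitely generated part of `P`. -/
theorem Submodule.exists_fg_torsionBySet_le {S : Type*} [CommRing S] (A : Type*) [AddCommGroup A]
    [Module S A] [IsArtinian S A] (P : Ideal S) :
    ∃ P₀ ≤ P, P₀.FG ∧
      Submodule.torsionBySet S A (P₀ : Set S) ≤ Submodule.torsionBySet S A (P : Set S) := by
  -- Choose `P₀` with `0 :_A P₀` minimal; adjoining any `p ∈ P` cannot shrink it, so `p` already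
  -- kills it.
  obtain ⟨_, ⟨P₀, ⟨hle, hfg⟩, rfl⟩, hmin⟩ := IsArtinian.set_has_minimal
    ((fun P₀ : Ideal S => Submodule.torsionBySet S A (P₀ : Set S)) '' {P₀ | P₀ ≤ P ∧ P₀.FG})
    ⟨_, ⊥, ⟨bot_le, Submodule.fg_bot⟩, rfl⟩
  refine ⟨P₀, hle, hfg, fun a ha => (Submodule.mem_torsionBySet_iff _ _).mpr fun p => ?_⟩
  have hP₁ : P₀ ⊔ Ideal.span {(p : S)} ≤ P :=
    sup_le hle ((Ideal.span_singleton_le_iff_mem P).mpr p.2)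
  have hanti := Submodule.torsionBySet_le_torsionBySet_of_subset (R := S) (M := A)
    (show (P₀ : Set S) ⊆ (P₀ ⊔ Ideal.span {(p : S)} : Ideal S) from
      (le_sup_left : P₀ ≤ P₀ ⊔ Ideal.span {(p : S)}))
  have heq := eq_of_le_of_not_lt hanti
    (hmin _ ⟨_, ⟨hP₁, Submodule.FG.sup hfg (Submodule.fg_span_singleton _)⟩, rfl⟩)
  have ha' := heq.ge ha
  exact (Submodule.mem_torsionBySet_iff _ _).mp ha'
    ⟨p, Ideal.mem_sup_right (Ideal.mem_span_singleton_self _)⟩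

/-! ### The Matlis dual -/

section Dual

variable {S : Type*} [CommRing S] [IsLocalRing S] {E : Type*} [AddCommGroup E] [Module S E]
  (hE : Module.Baer S E) {x : E} (hx0 : x ≠ 0) (hx : ∀ t ∈ maximalIdeal S, t • x = 0)
  {A : Type*} [AddCommGroup A] [Module S A]
  (hA : ∀ a : A, ∃ n : ℕ, ∀ t ∈ maximalIdeal S ^ n, t • a = 0)

-- `E` cogenerates: if `𝔪 ^ (k + 1)` is the least power killing `a`, some `r ∈ 𝔪 ^ k` makes `r • a`
-- a nonzero socle element. It spans a copy of `S / 𝔪`, and the map `r • a ↦ x` extends to `A` by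
-- injectivity.
include hE hx0 hx hA in
theorem Module.Baer.exists_apply_ne_zero {a : A} (ha : a ≠ 0) : ∃ φ : A →ₗ[S] E, φ a ≠ 0 := by
  classical
  have hmin := Nat.find_spec (hA a)
  obtain ⟨k, hk⟩ : ∃ k, Nat.find (hA a) = k + 1 := Nat.exists_eq_succ_of_ne_zero fun h0 => ha <| by
    rw [h0] at hmin
    simpa using hmin 1 (by simp)
  have hlt := Nat.find_min (hA a) (m := k) (by lia)
  push Not at hlt
  obtain ⟨r, hr, hra⟩ := hlt
  have hb (t : S) (ht : t ∈ maximalIdeal S) : t • r • a = 0 := by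
    rw [smul_smul]
    apply hmin
    rw [hk, pow_succ']
    exact Ideal.mul_mem_mul ht hr
  let i : (S ⧸ maximalIdeal S) →ₗ[S] A := (maximalIdeal S).liftQ
    (LinearMap.toSpanSingleton S A (r • a)) fun t ht => hb t ht
  let f : (S ⧸ maximalIdeal S) →ₗ[S] E := (maximalIdeal S).liftQ
    (LinearMap.toSpanSingleton S E x) fun t ht => hx t ht
  have hi : Function.Injective i := by
    refine LinearMap.ker_eq_bot.mp (Submodule.ker_liftQ_eq_bot _ _ _ fun t ht => ?_)
    by_contra htm
    have hu : IsUnit t := by simpa using htm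
    exact hra (hu.smul_eq_zero.mp ht)
  obtain ⟨φ, hφ⟩ := hE.extension_property i hi f
  refine ⟨φ, fun h => hx0 ?_⟩
  have h1 : φ (r • a) = x := by
    have h2 := congr($hφ (Submodule.Quotient.mk 1))
    change φ ((1 : S) • r • a) = (1 : S) • x at h2
    rwa [one_smul, one_smul] at h2
  rw [← h1, map_smul, h, smul_zero]

-- A map in `𝔪 ^ n Hom(A, E)` vanishes on every element killed by `𝔪 ^ n`, and such elements exhaust
-- `A`.
include hA in
theorem isHausdorff_linearMap_of_pow_torsion : IsHausdorff (maximalIdeal S) (A →ₗ[S] E) where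
  haus' φ hφ := by
    ext a
    obtain ⟨n, hn⟩ := hA a
    have hmem := (SModEq.zero).mp (hφ n)
    refine Submodule.smul_induction_on (p := fun ψ : A →ₗ[S] E => ψ a = 0) hmem ?_ ?_
    · intro t ht ψ _
      rw [LinearMap.smul_apply, ← map_smul, hn t ht, map_zero]
    · intro ψ χ h1 h2
      rw [LinearMap.add_apply, h1, h2, add_zero]

include hx in
/-- Maps out of an Artinian module killed by the maximal ideal to a module with cyclic socle form
a Noetherian module. -/
theorem isNoetherian_linearMap_of_isTorsionBySet
    (hsoc : ∀ e : E, (∀ t ∈ maximalIdeal S, t • e = 0) → e ∈ Submodule.span S {x})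
    [IsArtinian S A] (htors : Module.IsTorsionBySet S A (maximalIdeal S : Set S)) :
    IsNoetherian S (A →ₗ[S] E) := by
  have := htors.isSemisimpleModule_of_isMaximal
  have : Module.Finite S A := (IsSemisimpleModule.finite_tfae.out 2 0).mp ‹IsArtinian S A›
  obtain ⟨d, v, hv⟩ := Module.Finite.exists_fin (R := S) (M := A)
  have hxt : Module.IsTorsionBySet S (Submodule.span S {x}) (maximalIdeal S : Set S) := by
    rintro ⟨e, he⟩ ⟨t, ht⟩
    obtain ⟨s, rfl⟩ := Submodule.mem_span_singleton.mp he
    refine Subtype.ext ?_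
    change t • s • x = 0
    rw [smul_comm, hx t ht, smul_zero]
  have := hxt.isSemisimpleModule_of_isMaximal
  have : Module.Finite S (Submodule.span S {x}) := inferInstance
  have : IsNoetherian S (Submodule.span S {x}) :=
    (IsSemisimpleModule.finite_tfae.out 0 1).mp this
  -- A map is determined by its values on the generators `v j`; these are killed by `𝔪`, so they lie
  -- in the Noetherian module `S x`.
  let ev : (A →ₗ[S] E) →ₗ[S] (Fin d → Submodule.span S {x}) :=
    LinearMap.pi fun j => (LinearMap.applyₗ (v j)).codRestrict _ fun φ =>
      hsoc _ fun t ht => by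
        change t • φ (v j) = 0
        rw [← map_smul, show t • v j = 0 from @htors (v j) ⟨t, ht⟩, map_zero]
  refine isNoetherian_of_injective ev fun φ ψ h => LinearMap.ext_on_range hv fun j => ?_
  exact congr(Subtype.val ($h j))

include hE hx hA in
/-- The Matlis dual of an Artinian module over a complete local ring is finitely generated. -/
theorem Module.Baer.finite_linearMap_of_isArtinian
    (hsoc : ∀ e : E, (∀ t ∈ maximalIdeal S, t • e = 0) → e ∈ Submodule.span S {x})
    [IsPrecomplete (maximalIdeal S) S] (hfg : (maximalIdeal S).FG) [IsArtinian S A] :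
    Module.Finite S (A →ₗ[S] E) := by
  let T := Submodule.torsionBySet S A (maximalIdeal S : Set S)
  have := isNoetherian_linearMap_of_isTorsionBySet hx hsoc
    (Submodule.torsionBySet_isTorsionBySet (R := S) (M := A) (maximalIdeal S : Set S))
  -- Maps that vanish on the socle `T` lie in `𝔪 Hom(A, E)`, so lifts of generators of the range of
  -- restriction generate `Hom(A, E)` modulo `𝔪`. Completeness of `S ^ n` and separatedness of
  -- `Hom(A, E)` lift this surjectivity.
  let res : (A →ₗ[S] E) →ₗ[S] (T →ₗ[S] E) := LinearMap.lcomp S E T.subtype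
  obtain ⟨n, v, hv⟩ := Submodule.fg_iff_exists_fin_generating_family.mp
    (IsNoetherian.noetherian (LinearMap.range res))
  have hvr (j : Fin n) : v j ∈ LinearMap.range res := hv ▸ Submodule.subset_span ⟨j, rfl⟩
  choose φ hφ using hvr
  have := IsPrecomplete.pi_fin (maximalIdeal S) n
  have := isHausdorff_linearMap_of_pow_torsion (E := E) hA
  refine Module.Finite.of_surjective (Fintype.linearCombination S φ)
    (surjective_of_mkQ_comp_surjective (I := maximalIdeal S) fun y => ?_)
  obtain ⟨ψ, rfl⟩ := Submodule.Quotient.mk_surjective _ y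
  have hψ : res ψ ∈ Submodule.span S (Set.range v) := hv ▸ ⟨ψ, rfl⟩
  obtain ⟨c, hc⟩ := (Submodule.mem_span_range_iff_exists_fun S).mp hψ
  refine ⟨c, (Submodule.Quotient.eq _).mpr
    (hE.mem_smul_top_of_torsionBySet_le_ker hfg fun a ha => ?_)⟩
  have h := congr($hc ⟨a, ha⟩)
  simp only [← hφ, ← map_smul, ← map_sum] at h
  rw [LinearMap.mem_ker, LinearMap.sub_apply, sub_eq_zero, Fintype.linearCombination_apply]
  exact h

end Dual

/-! ### Property (*) over a complete local ring -/

/-- Artinian modules over complete local rings satisfy `Ann (0 :_A P) = P` for all primes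
`P ⊇ Ann A`. -/
theorem IsLocalRing.annihilator_torsionBySet_le_of_isPrecomplete {S : Type*} [CommRing S]
    [IsLocalRing S] [IsPrecomplete (maximalIdeal S) S] (hfg : (maximalIdeal S).FG)
    {A : Type*} [AddCommGroup A] [Module S A] [IsArtinian S A]
    (hA : ∀ a : A, ∃ n : ℕ, ∀ t ∈ maximalIdeal S ^ n, t • a = 0)
    (P : Ideal S) [P.IsPrime] (hP : Module.annihilator S A ≤ P) :
    Module.annihilator S (Submodule.torsionBySet S A (P : Set S)) ≤ P := by
  obtain ⟨E, x, hE, hx0, hx, hsoc⟩ := IsLocalRing.exists_baer_socle_span_singleton S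
  have := hE.finite_linearMap_of_isArtinian hx hA hsoc hfg
  intro s hs
  -- `S` is not assumed Noetherian, so `P` is replaced by a finitely generated ideal with the same
  -- torsion in `A`.
  obtain ⟨P₀, hP₀, hP₀fg, hle⟩ := Submodule.exists_fg_torsionBySet_le A P
  have hann : Module.annihilator S (A →ₗ[S] E) ≤ P := by
    refine le_trans (fun t ht => Module.mem_annihilator.mpr fun a => ?_) hP
    by_contra hta
    obtain ⟨φ, hφ⟩ := hE.exists_apply_ne_zero hx0 hx hA hta
    refine hφ ?_
    rw [map_smul]
    exact congr($(Module.mem_annihilator.mp ht φ) a)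
  have hsupp : (⟨P, ‹_›⟩ : PrimeSpectrum S) ∈
      Module.support S ((A →ₗ[S] E) ⧸ (P • ⊤ : Submodule S (A →ₗ[S] E))) := by
    rw [Module.support_quotient]
    exact ⟨Module.mem_support_iff_of_finite.mpr hann, (PrimeSpectrum.mem_zeroLocus _ _).mpr subset_rfl⟩
  refine Module.mem_support_iff_of_finite.mp hsupp (Module.mem_annihilator.mpr fun y => ?_)
  obtain ⟨φ, rfl⟩ := Submodule.Quotient.mk_surjective _ y
  rw [← Submodule.Quotient.mk_smul, Submodule.Quotient.mk_eq_zero]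
  refine Submodule.smul_mono_left hP₀
    (hE.mem_smul_top_of_torsionBySet_le_ker hP₀fg fun a ha => ?_)
  have := congr(Subtype.val $(Module.mem_annihilator.mp hs ⟨a, hle ha⟩))
  change s • a = 0 at this
  rw [LinearMap.mem_ker, LinearMap.smul_apply, ← map_smul, this, map_zero]

/-! ### Passage between `R` and its completion -/

namespace ArtinianCompletion

variable {R : Type*} [CommRing R] [IsLocalRing R] [IsNoetherianRing R]
  {A : Type*} [AddCommGroup A] [Module R A] [IsArtinian R A]

theorem isScalarTower_completion :
    letI := completionModule R A
    IsScalarTower R (AdicCompletion (maximalIdeal R) R) A := by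
  let _ := completionModule R A
  refine ⟨fun r x a => ?_⟩
  rw [Algebra.smul_def, mul_smul]
  exact completionSMul_algebraMap r (x • a)

/-- Every element of `A` is killed by a power of the maximal ideal of the completion of `R`. -/
theorem exists_pow_maximalIdeal_completion_smul_eq_zero (a : A) :
    letI := completionModule R A
    ∃ n : ℕ, ∀ t ∈ maximalIdeal (AdicCompletion (maximalIdeal R) R) ^ n, t • a = 0 := by
  let _ := completionModule R A
  obtain ⟨n, hn⟩ := exists_pow_smul_eq_zero (R := R) a
  refine ⟨n, fun t ht => ?_⟩
  have hle : maximalIdeal (AdicCompletion (maximalIdeal R) R) ^ n ≤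
      LinearMap.ker (LinearMap.toSpanSingleton (AdicCompletion (maximalIdeal R) R) A a) := by
    rw [AdicCompletion.maximalIdeal_eq_map, ← Ideal.map_pow, Ideal.map_le_iff_le_comap]
    intro r hr
    change algebraMap R (AdicCompletion (maximalIdeal R) R) r • a = 0
    exact (completionSMul_algebraMap r a).trans (hn r hr)
  exact hle ht

theorem comap_completionAnnihilator :
    (completionAnnihilator R A).comap (algebraMap R (AdicCompletion (maximalIdeal R) R)) =
      Module.annihilator R A := by
  let _ := completionModule R A
  ext r
  simp only [Ideal.mem_comap, completionAnnihilator, Module.mem_annihilator]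
  exact forall_congr' fun a => by rw [← completionSMul_algebraMap r a]; rfl

/-- Property (*) holds over the completion of `R`. -/
theorem annihilator_torsionBySet_completion_le
    (P : Ideal (AdicCompletion (maximalIdeal R) R)) [P.IsPrime]
    (hP : completionAnnihilator R A ≤ P) :
    letI := completionModule R A
    Module.annihilator (AdicCompletion (maximalIdeal R) R)
      (Submodule.torsionBySet (AdicCompletion (maximalIdeal R) R) A
        (P : Set (AdicCompletion (maximalIdeal R) R))) ≤ P := by
  let _ := completionModule R A
  have := isScalarTower_completion (R := R) (A := A)
  have : IsArtinian (AdicCompletion (maximalIdeal R) R) A := isArtinian_of_tower R ‹_›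
  have hfg : (maximalIdeal (AdicCompletion (maximalIdeal R) R)).FG := by
    rw [AdicCompletion.maximalIdeal_eq_map]
    exact (maximalIdeal R).fg_of_isNoetherianRing.map _
  exact IsLocalRing.annihilator_torsionBySet_le_of_isPrecomplete hfg
    exists_pow_maximalIdeal_completion_smul_eq_zero P hP

/-- Elements killed by `P` are killed by `P ∩ R`, so an `r` that kills `0 :_A (P ∩ R)` also kills `0
:_A P`, and property (*) over the completion puts its image in `P`. -/
theorem annihilator_torsionBySet_comap_le
    (P : Ideal (AdicCompletion (maximalIdeal R) R)) [P.IsPrime]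
    (hP : completionAnnihilator R A ≤ P) :
    Module.annihilator R (Submodule.torsionBySet R A
      (P.comap (algebraMap R (AdicCompletion (maximalIdeal R) R)) : Set R)) ≤
      P.comap (algebraMap R (AdicCompletion (maximalIdeal R) R)) := by
  let _ := completionModule R A
  intro r hr
  refine annihilator_torsionBySet_completion_le (A := A) P hP (Module.mem_annihilator.mpr ?_)
  rintro ⟨a, ha⟩
  refine Subtype.ext ?_
  rw [Submodule.mem_torsionBySet_iff] at ha
  have ha' : a ∈ Submodule.torsionBySet R A
      (P.comap (algebraMap R (AdicCompletion (maximalIdeal R) R)) : Set R) := by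
    rw [Submodule.mem_torsionBySet_iff]
    rintro ⟨t, ht⟩
    exact (completionSMul_algebraMap t a).symm.trans (ha ⟨_, ht⟩)
  exact (completionSMul_algebraMap r a).trans
    congr(Subtype.val $(Module.mem_annihilator.mp hr ⟨a, ha'⟩))

/-- The set `0 :_A p` is also an `R̂`-submodule `N`, and its annihilator `J` over `R̂` contracts to
`p`. A minimal prime over a contracted ideal, here `p` itself, is the contraction of a prime over
`J`. -/
theorem exists_isPrime_comap_eq_of_annihilator_torsionBySet_le (p : Ideal R) [p.IsPrime]
    (hp : Module.annihilator R (Submodule.torsionBySet R A (p : Set R)) ≤ p) :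
    ∃ P : Ideal (AdicCompletion (maximalIdeal R) R), P.IsPrime ∧ completionAnnihilator R A ≤ P ∧
      P.comap (algebraMap R (AdicCompletion (maximalIdeal R) R)) = p := by
  let _ := completionModule R A
  let N := Submodule.torsionBySet (AdicCompletion (maximalIdeal R) R) A
    (algebraMap R (AdicCompletion (maximalIdeal R) R) '' p)
  let J := Module.annihilator (AdicCompletion (maximalIdeal R) R) N
  have hN (a : A) : a ∈ N ↔ a ∈ Submodule.torsionBySet R A (p : Set R) := by
    simp only [N, Submodule.mem_torsionBySet_iff, Subtype.forall, Set.forall_mem_image]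
    exact forall₂_congr fun t _ => by rw [← completionSMul_algebraMap t a]; rfl
  have hJ : J.comap (algebraMap R (AdicCompletion (maximalIdeal R) R)) = p := by
    refine le_antisymm (fun r hr => hp (Module.mem_annihilator.mpr ?_)) fun r hr => ?_
    · rintro ⟨a, ha⟩
      exact Subtype.ext <| (completionSMul_algebraMap r a).symm.trans
        congr(Subtype.val $(Module.mem_annihilator.mp (Ideal.mem_comap.mp hr) ⟨a, (hN a).mpr ha⟩))
    · refine Ideal.mem_comap.mpr (Module.mem_annihilator.mpr ?_)
      rintro ⟨a, ha⟩
      exact Subtype.ext ((Submodule.mem_torsionBySet_iff _ _).mp ha ⟨_, r, hr, rfl⟩)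
  obtain ⟨P, hP, hJP, hPp⟩ := Ideal.exists_comap_eq_of_mem_minimalPrimes (I := J)
    (algebraMap R (AdicCompletion (maximalIdeal R) R)) p (by
      rw [hJ, Ideal.minimalPrimes_eq_subsingleton_self]
      rfl)
  refine ⟨P, hP, le_trans (fun x hx => Module.mem_annihilator.mpr fun a => ?_) hJP, hPp⟩
  exact Subtype.ext (Module.mem_annihilator.mp hx (a : A))

end ArtinianCompletion

open ArtinianCompletion in
theorem proposition2p2 {R : Type*} [CommRing R] [IsLocalRing R] [IsNoetherianRing R]
    {A : Type*} [AddCommGroup A] [Module R A] [IsArtinian R A] :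
    ArtinianCompletion.PropertyStar R A ↔
      PrimeSpectrum.zeroLocus (Module.annihilator R A : Set R) =
        PrimeSpectrum.comap
            (algebraMap R (AdicCompletion (IsLocalRing.maximalIdeal R) R)) ''
          PrimeSpectrum.zeroLocus (ArtinianCompletion.completionAnnihilator R A :
            Set (AdicCompletion (IsLocalRing.maximalIdeal R) R)) := by
  constructor
  · intro h
    apply Set.Subset.antisymm
    · intro p hp
      obtain ⟨P, hP, hle, hcomap⟩ := exists_isPrime_comap_eq_of_annihilator_torsionBySet_le
        (A := A) p.asIdeal (h p.asIdeal p.isPrime hp).le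
      exact ⟨⟨P, hP⟩, hle, PrimeSpectrum.ext hcomap⟩
    · rintro _ ⟨P, hP, rfl⟩
      rw [PrimeSpectrum.mem_zeroLocus, SetLike.coe_subset_coe] at hP ⊢
      rw [← comap_completionAnnihilator]
      exact Ideal.comap_mono hP
  · intro h p hp hAp
    obtain ⟨P, hP, hPp⟩ := h.le (show (⟨p, hp⟩ : PrimeSpectrum R) ∈ _ from hAp)
    obtain rfl : P.asIdeal.comap (algebraMap R _) = p := congr_arg PrimeSpectrum.asIdeal hPp
    refine le_antisymm (annihilator_torsionBySet_comap_le P.asIdeal hP) fun r hr => ?_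
    refine Module.mem_annihilator.mpr fun a => Subtype.ext ?_
    exact (Submodule.mem_torsionBySet_iff _ _).mp a.2 ⟨r, hr⟩
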